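/- Let $\mathbb X=(X_n)_{n\ge1}$ be a strictly stationary sequence of real random variables on an arbitrary probability space $(\Omega,\mathcal F,\mathbb P)$, let $a>0$, and let $(k_n)_{n\ge1}$ be integers with $1\le k_n\le n$ for all $n$ and $k_n/n\to1$. Let $X_{1:n}\le\dots\le X_{n:n}$ be the order statistics of $X_1,\dots,X_n$ and put $$K(k_n,n,a)=\sum_{i=1}^n I\big(X_{k_n:n}-a<X_i<X_{k_n:n}\big).$$ Let $\mathcal I^{\mathbb X}$ be the $\sigma$-field of all sets $A\subseteq\Omega$ for which there is a Borel set $B\subseteq\mathbb R^{\mathbb N}$ such that $A=\{\omega:(X_i(\omega),X_{i+1}(\omega),\dots)\in B\}$ for every $i\ge1$. Let $\gamma=\gamma_1(X_1|\mathcal I^{\mathbb X})$ be (any version of) the conditional right endpoint of the support of $X_1$ given $\mathcal I^{\mathbb X}$, that is, an $\mathcal I^{\mathbb X}$-measurable function $\gamma:\Omega\to[-\infty,\infty]$ such that $\mathbb P(X_1\le\gamma\mid\mathcal I^{\mathbb X})=1$ a.s. and such that $\gamma\le Q$ a.s. for every $\mathcal I^{\mathbb X}$-measurable $Q:\Omega\to[-\infty,\infty]$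 with $\mathbb P(X_1\le Q\mid\mathcal I^{\mathbb X})=1$ a.s. Assume that $$\mathbb P(X_1=\gamma)=0\qquad\text{and}\qquad\mathbb P(X_1=\gamma-a)=0 .$$ Then, as $n\to\infty$, $$\frac{K(k_n,n,a)}{n}\longrightarrow\mathbb P\big(X_1>\gamma-a\,\big|\,\mathcal I^{\mathbb X}\big)\qquad\mathbb P\text{-a.s.}$$ -/

import Mathlib

open MeasureTheory ProbabilityTheory Filter Topology

/-- A sequence of random variables (indexed from `0`, so that `X 0` is the first one) is strictly
stationary: every shifted sequence has the same joint law as the sequence itself. -/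
def StrictlyStationary {Ω : Type*} [MeasurableSpace Ω] (μ : Measure Ω) (X : ℕ → Ω → ℝ) : Prop :=
  ∀ m : ℕ, IdentDistrib (fun ω (i : ℕ) => X (m + i) ω) (fun ω (i : ℕ) => X i ω) μ μ

/-- The σ-field of the events that are invariant with respect to the sequence `X`, that is, of the
sets `A` for which there is a Borel set `B` of real sequences such that
`A = {ω | (X i ω, X (i + 1) ω, …) ∈ B}` for every `i`. -/
@[reducible] def invariantSigma {Ω : Type*} (X : ℕ → Ω → ℝ) : MeasurableSpace Ω where
  MeasurableSet' A := ∃ B : Set (ℕ → ℝ), MeasurableSet B ∧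
    ∀ i : ℕ, A = {ω | (fun j : ℕ => X (i + j) ω) ∈ B}
  measurableSet_empty := ⟨∅, MeasurableSet.empty, fun _ => by simp⟩
  measurableSet_compl := by
    rintro A ⟨B, hB, h⟩
    exact ⟨Bᶜ, hB.compl, fun i => by rw [h i]; rfl⟩
  measurableSet_iUnion := by
    intro f hf
    choose B hB h using hf
    refine ⟨⋃ n, B n, MeasurableSet.iUnion hB, fun i => ?_⟩
    ext ω
    simp only [Set.mem_iUnion, Set.mem_ofPred_eq]
    exact exists_congr fun n => by rw [h n i]; rfl

/-- `γ` is (a version of) the conditional right endpoint of the support of `Y` given the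
σ-field `𝒢`: the a.s. smallest `𝒢`-measurable extended random variable that is a.s. at
least `Y`, given `𝒢`. -/
structure IsCondRightEndpoint {Ω : Type*} [mΩ : MeasurableSpace Ω] (μ : Measure Ω) (Y : Ω → ℝ)
    (𝒢 : MeasurableSpace Ω) (γ : Ω → EReal) : Prop where
  measurable : Measurable[𝒢] γ
  le_endpoint : μ⟦{ω | (Y ω : EReal) ≤ γ ω} | 𝒢⟧ =ᵐ[μ] fun _ => (1 : ℝ)
  minimal : ∀ Q : Ω → EReal, Measurable[𝒢] Q →
    μ⟦{ω | (Y ω : EReal) ≤ Q ω} | 𝒢⟧ =ᵐ[μ] (fun _ => (1 : ℝ)) → γ ≤ᵐ[μ] Q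

/-- The `k`-th smallest (`1 ≤ k ≤ n`) of the numbers `x 0, …, x (n - 1)`, counted with
multiplicity. -/
noncomputable def orderStat (x : ℕ → ℝ) (k n : ℕ) : ℝ :=
  if h : 1 ≤ k ∧ k ≤ n then
    (fun i : Fin n => x i) (Tuple.sort (fun i : Fin n => x i) ⟨k - 1, by omega⟩)
  else 0

open scoped Classical in
/-- The number of those among `x 0, …, x (n - 1)` that lie strictly within distance `a` to the left
of their `k`-th order statistic. -/
noncomputable def nearCount (x : ℕ → ℝ) (k n : ℕ) (a : ℝ) : ℕ :=
  ((Finset.range n).filter fun i => orderStat x k n - a < x i ∧ x i < orderStat x k n).card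

theorem invariantSigma_le {Ω : Type*} [mΩ : MeasurableSpace Ω] (X : ℕ → Ω → ℝ)
    (hX : ∀ i, Measurable (X i)) : invariantSigma X ≤ mΩ := by
  rintro A ⟨B, hB, h⟩
  rw [h 0]
  exact (measurable_pi_lambda _ fun j => hX (0 + j)) hB

theorem condProb_eq_one_iff {Ω : Type*} [mΩ : MeasurableSpace Ω] (μ : Measure Ω)
    [IsProbabilityMeasure μ] (𝒢 : MeasurableSpace Ω) (h𝒢 : 𝒢 ≤ mΩ) (s : Set Ω)
    (hs : MeasurableSet[mΩ] s) :
    (μ⟦s | 𝒢⟧ =ᵐ[μ] fun _ => (1 : ℝ)) ↔ ∀ᵐ ω ∂μ, ω ∈ s := by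
  constructor
  · intro h
    have h1 : ∫ ω, (μ⟦s | 𝒢⟧) ω ∂μ = ∫ ω, s.indicator (fun _ => (1 : ℝ)) ω ∂μ :=
      integral_condExp h𝒢
    rw [integral_congr_ae h, integral_indicator hs] at h1
    simp at h1
    have h2 : μ s = 1 := by
      rw [measureReal_def] at h1
      rw [← ENNReal.ofReal_toReal (measure_ne_top μ s), ← h1]; simp
    exact (prob_compl_eq_zero_iff hs).2 h2
  · intro h
    have : s.indicator (fun _ => (1 : ℝ)) =ᵐ[μ] fun _ => 1 := by
      filter_upwards [h] with ω hω
      simp [hω]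
    refine (condExp_congr_ae this).trans ?_
    rw [condExp_const h𝒢]

/-- Every random variable has a conditional right endpoint given every sub-σ-field. -/
theorem exists_isCondRightEndpoint {Ω : Type*} (𝒢 : MeasurableSpace Ω) [mΩ : MeasurableSpace Ω]
    (μ : Measure Ω) [IsProbabilityMeasure μ] (Y : Ω → ℝ) (hY : Measurable[mΩ] Y)
    (h𝒢 : 𝒢 ≤ mΩ) : ∃ γ : Ω → EReal, IsCondRightEndpoint μ Y 𝒢 γ := by
  have hS : ∀ q : ℚ, MeasurableSet[mΩ] {ω | Y ω ≤ q} := fun q => hY measurableSet_Iic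
  let G : ℚ → Set Ω := fun q => {ω | (μ⟦{ω | Y ω ≤ q} | 𝒢⟧) ω = 1}
  have hG : ∀ q, MeasurableSet[𝒢] (G q) := fun q =>
    (stronglyMeasurable_condExp.measurable : Measurable[𝒢] _) (measurableSet_singleton 1)
  classical
  let γ : Ω → EReal := fun ω => ⨅ q : ℚ, if ω ∈ G q then ((q : ℝ) : EReal) else ⊤
  have hmeas (Q : Ω → EReal) (hQ : Measurable[𝒢] Q) :
      MeasurableSet[mΩ] {ω | (Y ω : EReal) ≤ Q ω} :=
    measurableSet_le (measurable_coe_real_ereal.comp hY) (hQ.mono h𝒢 le_rfl)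
  have hγ : Measurable[𝒢] γ := by
    refine Measurable.iInf fun q => ?_
    exact Measurable.ite (hG q) measurable_const measurable_const
  refine ⟨γ, hγ, ?_, ?_⟩
  · rw [condProb_eq_one_iff μ 𝒢 h𝒢 _ (hmeas γ hγ)]
    have : ∀ q : ℚ, ∀ᵐ ω ∂μ, ω ∈ G q → Y ω ≤ q := by
      intro q
      have h1 : ∫ ω in G q, (μ⟦{ω | Y ω ≤ q} | 𝒢⟧) ω ∂μ
          = ∫ ω in G q, ({ω | Y ω ≤ q}.indicator (fun _ => (1 : ℝ))) ω ∂μ :=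
        setIntegral_condExp h𝒢 ((integrable_const 1).indicator (hS q)) (hG q)
      rw [setIntegral_congr_fun (g := fun _ => (1 : ℝ)) (h𝒢 _ (hG q)) (fun ω hω => hω),
        setIntegral_indicator (hS q)] at h1
      simp only [integral_const, smul_eq_mul, mul_one, measureReal_restrict_apply_univ] at h1
      have h2 : μ (G q \ {ω | Y ω ≤ q}) = 0 := by
        have h3 := measureReal_inter_add_sdiff (μ := μ) (s := G q) (hS q)
        rw [← measureReal_eq_zero_iff]
        linarith
      rw [ae_iff]
      convert h2 using 2
      ext ω
      simp
    filter_upwards [ae_all_iff.2 this] with ω hω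
    refine le_iInf fun q => ?_
    split_ifs with h
    · exact_mod_cast hω q h
    · exact le_top
  · intro Q hQ h
    rw [condProb_eq_one_iff μ 𝒢 h𝒢 _ (hmeas Q hQ)] at h
    have : ∀ q : ℚ, ∀ᵐ ω ∂μ, Q ω ≤ ((q : ℝ) : EReal) → ω ∈ G q := by
      intro q
      have hA : MeasurableSet[𝒢] {ω | Q ω ≤ ((q : ℝ) : EReal)} := hQ measurableSet_Iic
      have h1 := condExp_indicator (m := 𝒢) (μ := μ)
        ((integrable_const (1 : ℝ)).indicator (hS q)) hA
      have h2 : {ω | Q ω ≤ ((q : ℝ) : EReal)}.indicator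
          ({ω | Y ω ≤ q}.indicator (fun _ => (1 : ℝ))) =ᵐ[μ]
          {ω | Q ω ≤ ((q : ℝ) : EReal)}.indicator (fun _ => (1 : ℝ)) := by
        filter_upwards [h] with ω hω
        by_cases hq : Q ω ≤ ((q : ℝ) : EReal)
        · have : Y ω ≤ q := by exact_mod_cast le_trans hω hq
          simp [hq, this]
        · simp [hq]
      have h3 := condExp_congr_ae (m := 𝒢) h2
      rw [condExp_of_stronglyMeasurable h𝒢 (stronglyMeasurable_const.indicator hA)
        ((integrable_const (1 : ℝ)).indicator (h𝒢 _ hA))] at h3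
      filter_upwards [h1, h3] with ω e1 e3 hq
      rw [e1] at e3
      simpa [G, hq] using e3
    filter_upwards [ae_all_iff.2 this] with ω hω
    refine le_of_forall_gt fun c hc => ?_
    obtain ⟨q, hq1, hq2⟩ := EReal.exists_rat_btwn_of_lt hc
    refine lt_of_le_of_lt (iInf_le _ q) ?_
    rw [if_pos (hω q hq1.le)]
    exact hq2

/-!
By Birkhoff's ergodic theorem, the proportion of `i < n` with `X i > c` converges almost surely to
`P(X 0 > c | ℐ)` for every level `c` that is measurable with respect to the invariant σ-field `ℐ`.
Take levels `u m < γ` increasing to the conditional right endpoint `γ`. Minimality of `γ` makes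
the limiting proportion above each `u m` positive, whereas the proportion of indices left out by the
rank `k n` vanishes; hence the order statistic of rank `k n` eventually lies in `(u m, γ]`. So
`nearCount / n` is at most the proportion above `u m - a`, and at least the proportion above `γ - a`
minus the proportion above `u m`. As `m → ∞` both bounds tend to `P(X 0 > γ - a | ℐ)`, because
neither `γ` nor `γ - a` is charged by `X 0`.
-/

section Birkhoff

variable {α : Type*} {T : α → α} {f h : α → ℝ}

/-- The running maximum `max_{1 ≤ j ≤ n + 1} birkhoffSum T h j` of the nonempty Birkhoff sums, the
auxiliary sequence of Garsia's proof of the maximal ergodic inequality. -/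
noncomputable def birkhoffMax (T : α → α) (h : α → ℝ) : ℕ →o (α → ℝ) :=
  partialSups fun n => birkhoffSum T h (n + 1)

theorem birkhoffMax_zero : birkhoffMax T h 0 = h := by
  simp [birkhoffMax]

theorem birkhoffMax_succ_apply (n : ℕ) (x : α) :
    birkhoffMax T h (n + 1) x = h x + max 0 (birkhoffMax T h n (T x)) := by
  have max_birkhoffSum (n : ℕ) : birkhoffMax T h (n + 1) x =
      max (birkhoffMax T h n x) (h x + birkhoffSum T h (n + 1) (T x)) := by
    rw [← birkhoffSum_succ', birkhoffMax, partialSups_add_one, Pi.sup_apply]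
  induction n with
  | zero => rw [max_birkhoffSum, birkhoffMax_zero, birkhoffSum_one, ← max_add_add_left, add_zero]
  | succ n ih =>
    rw [max_birkhoffSum, ih, max_add_add_left, max_assoc, birkhoffMax, partialSups_add_one,
      Pi.sup_apply]

theorem birkhoffSum_le_birkhoffMax (n : ℕ) (x : α) :
    birkhoffSum T h (n + 1) x ≤ birkhoffMax T h n x :=
  le_partialSups (fun n => birkhoffSum T h (n + 1)) n x

theorem le_birkhoffMax (n : ℕ) (x : α) : h x ≤ birkhoffMax T h n x := by
  simpa only [birkhoffMax_zero] using (birkhoffMax T h).monotone n.zero_le x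

theorem tendsto_birkhoffMax_apply_iff (x : α) :
    Tendsto (fun n => birkhoffMax T h n (T x)) atTop atTop ↔
      Tendsto (fun n => birkhoffMax T h n x) atTop atTop := by
  rw [← tendsto_add_atTop_iff_nat (f := fun n => birkhoffMax T h n x) 1]
  simp only [birkhoffMax_succ_apply]
  refine ⟨fun H => tendsto_atTop_add_const_left _ _ <|
    tendsto_atTop_mono (fun n => le_max_right _ _) H, fun H => ?_⟩
  have hmax : Tendsto (fun n => max 0 (birkhoffMax T h n (T x))) atTop atTop := by
    simpa only [neg_add_cancel_left] using tendsto_atTop_add_const_left _ (-h x) H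
  refine hmax.congr' ?_
  filter_upwards [hmax.eventually_gt_atTop 0] with n hn
  exact max_eq_right ((lt_max_iff.1 hn).resolve_left (lt_irrefl 0)).le

theorem eventually_birkhoffAverage_lt {x : α}
    (hbdd : BddAbove (Set.range fun n => birkhoffSum T h (n + 1) x)) {ε : ℝ} (hε : 0 < ε) :
    ∀ᶠ n : ℕ in atTop, birkhoffAverage ℝ T h n x < ε := by
  obtain ⟨M, hM⟩ := hbdd
  have hlim : Tendsto (fun n : ℕ => M / n) atTop (𝓝 0) := tendsto_const_div_atTop_nhds_zero_nat M
  filter_upwards [hlim.eventually_lt_const hε, eventually_ge_atTop 1] with n hn hn_pos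
  refine lt_of_le_of_lt ?_ hn
  have hsum : birkhoffSum T h n x ≤ M := by
    simpa only [Nat.sub_add_cancel hn_pos] using hM (Set.mem_range_self (n - 1))
  rw [birkhoffAverage, smul_eq_mul, inv_mul_eq_div]
  gcongr

variable [MeasurableSpace α] {μ : Measure α}

theorem measurable_birkhoffMax (hT : Measurable T) (hh : Measurable h) (n : ℕ) :
    Measurable (birkhoffMax T h n) := by
  induction n with
  | zero => rwa [birkhoffMax_zero]
  | succ n ih =>
    rw [funext (birkhoffMax_succ_apply n)]
    exact hh.add (measurable_const.max (ih.comp hT))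

theorem integrable_birkhoffMax (hT : MeasurePreserving T μ μ) (hh : Integrable h μ) (n : ℕ) :
    Integrable (birkhoffMax T h n) μ := by
  induction n with
  | zero => rwa [birkhoffMax_zero]
  | succ n ih =>
    rw [funext (birkhoffMax_succ_apply n)]
    exact hh.add ((integrable_zero _ _ _).sup (hT.integrable_comp_of_integrable ih))

theorem measurableSet_tendsto_birkhoffMax (hT : Measurable T) (hh : Measurable h) :
    MeasurableSet[MeasurableSpace.invariants T]
      {x | Tendsto (fun n => birkhoffMax T h n x) atTop atTop} :=
  ⟨measurableSet_tendsto _ (measurable_birkhoffMax hT hh),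
    Set.ext fun x => tendsto_birkhoffMax_apply_iff x⟩

theorem integral_birkhoffMax_succ (hT : MeasurePreserving T μ μ) (hh : Integrable h μ) (n : ℕ) :
    ∫ x, birkhoffMax T h (n + 1) x ∂μ =
      ∫ x, h x ∂μ + (∫ x, birkhoffMax T h n x ∂μ + ∫ x, max (-birkhoffMax T h n x) 0 ∂μ) := by
  have hF := integrable_birkhoffMax hT hh n
  have hF' : Integrable (fun x => birkhoffMax T h n x + max (-birkhoffMax T h n x) 0) μ :=
    hF.add hF.neg_part
  have max_zero_eq (y : ℝ) : max 0 y = y + max (-y) 0 := by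
    rw [← max_add_add_left, add_neg_cancel, add_zero]
  simp only [birkhoffMax_succ_apply, max_zero_eq]
  have integral_comp : ∫ x, (birkhoffMax T h n (T x) + max (-birkhoffMax T h n (T x)) 0) ∂μ =
      ∫ x, (birkhoffMax T h n x + max (-birkhoffMax T h n x) 0) ∂μ := by
    conv_rhs => rw [← hT.map_eq]
    exact (integral_map hT.aemeasurable (hT.map_eq.symm ▸ hF'.aestronglyMeasurable)).symm
  rw [← integral_add hF hF.neg_part, ← integral_comp]
  exact integral_add hh (hT.integrable_comp_of_integrable hF')

theorem integral_nonneg_of_tendsto_birkhoffMax (hT : MeasurePreserving T μ μ)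
    (hh : Integrable h μ) (htop : ∀ᵐ x ∂μ, Tendsto (fun n => birkhoffMax T h n x) atTop atTop) :
    0 ≤ ∫ x, h x ∂μ := by
  have hF (n : ℕ) := integrable_birkhoffMax hT hh n
  have negPart_tendsto : Tendsto (fun n => ∫ x, max (-birkhoffMax T h n x) 0 ∂μ) atTop (𝓝 0) := by
    suffices Tendsto (fun n => ∫ x, max (-birkhoffMax T h n x) 0 ∂μ) atTop (𝓝 (∫ _, 0 ∂μ)) by
      simpa only [integral_zero] using this
    refine tendsto_integral_of_dominated_convergence (fun x => |h x|)
      (fun n => (hF n).neg_part.aestronglyMeasurable) hh.abs (fun n => ?_) ?_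
    · filter_upwards with x
      rw [Real.norm_of_nonneg (le_max_right _ _)]
      exact max_le ((neg_le_neg (le_birkhoffMax n x)).trans (neg_le_abs _)) (abs_nonneg _)
    · filter_upwards [htop] with x hx
      refine tendsto_const_nhds.congr' ?_
      filter_upwards [hx.eventually_ge_atTop 0] with n hn
      exact (max_eq_right (neg_nonpos.2 hn)).symm
  have key := negPart_tendsto.const_add (∫ x, h x ∂μ)
  rw [add_zero] at key
  refine ge_of_tendsto' key fun n => ?_
  have hmono : ∫ x, birkhoffMax T h n x ∂μ ≤ ∫ x, birkhoffMax T h (n + 1) x ∂μ :=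
    integral_mono (hF n) (hF (n + 1)) ((birkhoffMax T h).monotone n.le_succ)
  rw [integral_birkhoffMax_succ hT hh] at hmono
  linarith

theorem setIntegral_nonneg_of_tendsto_birkhoffMax (hT : MeasurePreserving T μ μ)
    (hm : Measurable h) (hh : Integrable h μ) :
    0 ≤ ∫ x in {x | Tendsto (fun n => birkhoffMax T h n x) atTop atTop}, h x ∂μ := by
  obtain ⟨hA, hTA⟩ := measurableSet_tendsto_birkhoffMax hT.measurable hm
  have hT_restrict := hT.restrict_preimage hA
  rw [hTA] at hT_restrict
  exact integral_nonneg_of_tendsto_birkhoffMax hT_restrict hh.restrict (ae_restrict_mem hA)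

theorem ae_bddAbove_birkhoffSum [IsFiniteMeasure μ] (hT : MeasurePreserving T μ μ)
    (hm : Measurable h) (hh : Integrable h μ)
    (hneg : ∀ᵐ x ∂μ, (μ[h | MeasurableSpace.invariants T]) x < 0) :
    ∀ᵐ x ∂μ, BddAbove (Set.range fun n => birkhoffSum T h (n + 1) x) := by
  have hle := MeasurableSpace.invariants_le T
  have hA := measurableSet_tendsto_birkhoffMax hT.measurable hm
  have hnonneg := setIntegral_nonneg_of_tendsto_birkhoffMax hT hm hh
  rw [← setIntegral_condExp hle hh hA] at hnonneg
  have hle_zero : μ[h | MeasurableSpace.invariants T] ≤ᵐ[μ] 0 := hneg.mono fun x hx => hx.le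
  have hzero := (setIntegral_eq_zero_iff_of_nonneg_ae
    (f := -μ[h | MeasurableSpace.invariants T])
    (ae_restrict_of_ae (hle_zero.mono fun x => neg_nonneg.2)) integrable_condExp.neg.integrableOn).1
    (le_antisymm (by simpa only [Pi.neg_apply, integral_neg, neg_nonpos] using hnonneg) <|
      integral_nonneg_of_ae (ae_restrict_of_ae (hle_zero.mono fun x => neg_nonneg.2)))
  filter_upwards [hneg, (ae_restrict_iff' (hle _ hA)).1 hzero] with x hx hx_zero
  have hx_not : ¬Tendsto (fun n => birkhoffMax T h n x) atTop atTop := fun hxA =>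
    hx.ne (neg_eq_zero.1 (hx_zero hxA))
  have hmono : Monotone fun n => birkhoffMax T h n x :=
    fun m n hmn => (birkhoffMax T h).monotone hmn x
  obtain ⟨M, hM⟩ := not_imp_comm.1 (tendsto_atTop_atTop_of_monotone' hmono) hx_not
  exact ⟨M, Set.forall_mem_range.2 fun n =>
    (birkhoffSum_le_birkhoffMax n x).trans (hM (Set.mem_range_self n))⟩

theorem ae_eventually_birkhoffAverage_lt [IsFiniteMeasure μ] (hT : MeasurePreserving T μ μ)
    (hfm : Measurable f) (hf : Integrable f μ) {ε : ℝ} (hε : 0 < ε) :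
    ∀ᵐ x ∂μ, ∀ᶠ n : ℕ in atTop,
      birkhoffAverage ℝ T f n x < (μ[f | MeasurableSpace.invariants T]) x + ε := by
  have hle := MeasurableSpace.invariants_le T
  set c : α → ℝ := μ[f | MeasurableSpace.invariants T] + fun _ => ε / 2 with hc
  have hc_meas : StronglyMeasurable[MeasurableSpace.invariants T] c :=
    stronglyMeasurable_condExp.add stronglyMeasurable_const
  have hc_int : Integrable c μ := integrable_condExp.add (integrable_const _)
  have hc_inv : c ∘ T = c := MeasurableSpace.comp_eq_of_measurable_invariants hc_meas.measurable
  have hneg : ∀ᵐ x ∂μ, (μ[f - c | MeasurableSpace.invariants T]) x < 0 := by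
    filter_upwards [condExp_sub hf hc_int (MeasurableSpace.invariants T)] with x hx
    rw [hx, condExp_of_stronglyMeasurable hle hc_meas hc_int]
    simp only [hc, Pi.sub_apply, Pi.add_apply]
    linarith
  filter_upwards [ae_bddAbove_birkhoffSum hT (hfm.sub (hc_meas.measurable.mono hle le_rfl))
    (hf.sub hc_int) hneg] with x hx
  filter_upwards [eventually_birkhoffAverage_lt hx (half_pos hε), eventually_ge_atTop 1]
    with n hn hn_pos
  rw [birkhoffAverage_sub, Pi.sub_apply, Pi.sub_apply,
    birkhoffAverage_of_comp_eq ℝ hc_inv (by positivity)] at hn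
  simp only [hc, Pi.add_apply] at hn
  linarith

theorem ae_tendsto_birkhoffAverage [IsFiniteMeasure μ] (hT : MeasurePreserving T μ μ)
    (hf : Integrable f μ) :
    ∀ᵐ x ∂μ, Tendsto (fun n : ℕ => birkhoffAverage ℝ T f n x) atTop
      (𝓝 ((μ[f | MeasurableSpace.invariants T]) x)) := by
  wlog hfm : Measurable f generalizing f
  · filter_upwards [this (hf.congr hf.1.ae_eq_mk) hf.1.measurable_mk,
      condExp_congr_ae (m := MeasurableSpace.invariants T) hf.1.ae_eq_mk,
      ae_all_iff.2 (hT.quasiMeasurePreserving.birkhoffAverage_ae_eq_of_ae_eq ℝ hf.1.ae_eq_mk)]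
      with x hx hcondExp haverage
    simpa only [hcondExp, haverage] using hx
  have ae_forall_eventually {f : α → ℝ} (hfm : Measurable f) (hf : Integrable f μ) :=
    ae_all_iff.2 fun m : ℕ =>
      ae_eventually_birkhoffAverage_lt hT hfm hf (Nat.one_div_pos_of_nat (α := ℝ) (n := m))
  filter_upwards [ae_forall_eventually hfm hf, ae_forall_eventually hfm.neg hf.neg,
    condExp_neg (μ := μ) f (MeasurableSpace.invariants T)] with x hupper hlower hneg
  rw [Metric.tendsto_nhds]
  intro δ hδ
  obtain ⟨m, hm⟩ := exists_nat_one_div_lt hδ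
  filter_upwards [hupper m, hlower m] with n hn_upper hn_lower
  rw [hneg, birkhoffAverage_neg] at hn_lower
  simp only [Pi.neg_apply] at hn_lower
  rw [Real.dist_eq, abs_lt]
  constructor <;> linarith

end Birkhoff

section Stationary

theorem measurableSet_invariants_frequently {α : Type*} [MeasurableSpace α] {T : α → α}
    (hT : Measurable T) {B : Set α} (hB : MeasurableSet B) :
    MeasurableSet[MeasurableSpace.invariants T] {x | ∃ᶠ i in atTop, T^[i] x ∈ B} := by
  constructor
  · have hlimsup : {x | ∃ᶠ i in atTop, T^[i] x ∈ B} = limsup (fun i => T^[i] ⁻¹' B) atTop := by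
      ext x
      rw [mem_limsup_iff_frequently_mem]
      rfl
    rw [hlimsup]
    exact MeasurableSet.measurableSet_limsup fun i => hT.iterate i hB
  · ext x
    simp only [Set.preimage_ofPred_eq, Set.mem_ofPred_eq, ← Function.iterate_succ_apply]
    conv_rhs => rw [← map_add_atTop_eq_nat 1, frequently_map]

/-- The left shift on sequences. -/
def seqShift {β : Type*} (x : ℕ → β) : ℕ → β := fun j => x (j + 1)

theorem measurable_seqShift {β : Type*} [MeasurableSpace β] :
    Measurable (seqShift : (ℕ → β) → ℕ → β) :=
  measurable_pi_lambda _ fun j => measurable_pi_apply (j + 1)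

theorem seqShift_iterate {β : Type*} (i : ℕ) (x : ℕ → β) :
    seqShift^[i] x = fun j => x (i + j) := by
  induction i generalizing x with
  | zero => simp only [Function.iterate_zero, id_eq, zero_add]
  | succ i ih =>
    rw [Function.iterate_succ_apply, ih]
    simp only [seqShift, Nat.succ_add]

variable {Ω : Type*} {X : ℕ → Ω → ℝ}

theorem invariantSigma_eq_comap (X : ℕ → Ω → ℝ) :
    invariantSigma X =
      (MeasurableSpace.invariants seqShift).comap fun ω (i : ℕ) => X i ω := by
  ext A
  rw [MeasurableSpace.measurableSet_comap]
  constructor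
  · -- `B` need not be shift-invariant; the set of sequences visiting `B` infinitely often is.
    rintro ⟨B, hB, hA⟩
    refine ⟨_, measurableSet_invariants_frequently measurable_seqShift hB, ?_⟩
    ext ω
    have hω (i : ℕ) : (fun j => X (i + j) ω) ∈ B ↔ ω ∈ A := by
      rw [hA i]
      rfl
    simp only [Set.preimage_ofPred_eq, Set.mem_ofPred_eq, seqShift_iterate, hω,
      frequently_const]
  · rintro ⟨B, hB, rfl⟩
    refine ⟨B, hB.1, fun i => ?_⟩
    have hi : seqShift^[i] ⁻¹' B = B := (MeasurableSpace.le_invariants_iterate seqShift i B hB).2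
    conv_lhs => rw [← hi]
    ext ω
    rw [Set.mem_preimage, Set.mem_preimage, seqShift_iterate]
    rfl

theorem exists_measurable_eq_comp_shift {c : Ω → EReal} (hc : Measurable[invariantSigma X] c) :
    ∃ g : (ℕ → ℝ) → EReal, Measurable g ∧
      (∀ ω, g (fun j => X j ω) = c ω) ∧ ∀ i ω, g (fun j => X (i + j) ω) = c ω := by
  rw [invariantSigma_eq_comap] at hc
  obtain ⟨g, hg, rfl⟩ := Measurable.exists_eq_measurable_comp
    (mY := MeasurableSpace.invariants seqShift) hc
  refine ⟨g, hg.mono (MeasurableSpace.invariants_le _) le_rfl, fun ω => rfl, fun i ω => ?_⟩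
  have hgi : g ∘ seqShift^[i] = g := MeasurableSpace.comp_eq_of_measurable_invariants
    (hg.mono (MeasurableSpace.le_invariants_iterate _ i) le_rfl)
  simpa only [Function.comp_apply, seqShift_iterate] using congrFun hgi fun j => X j ω

theorem condExp_comp_comap {β E : Type*} [NormedAddCommGroup E] [NormedSpace ℝ E] [CompleteSpace E]
    {mΩ : MeasurableSpace Ω} {μ : Measure Ω} [IsFiniteMeasure μ]
    {m mβ : MeasurableSpace β} {φ : Ω → β} (hφ : Measurable φ) (hm : m ≤ mβ)
    {f : β → E} (hf : Integrable f (μ.map φ)) :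
    μ[f ∘ φ | m.comap φ] =ᵐ[μ] (μ.map φ)[f | m] ∘ φ := by
  have hle : m.comap φ ≤ mΩ := (MeasurableSpace.comap_mono hm).trans hφ.comap_le
  have hint : Integrable ((μ.map φ)[f | m] ∘ φ) μ := integrable_condExp.comp_measurable hφ
  refine (ae_eq_condExp_of_forall_setIntegral_eq hle (hf.comp_measurable hφ)
    (fun s _ _ => hint.integrableOn) ?_ ?_).symm
  · rintro _ ⟨B, hB, rfl⟩ -
    simp only [Function.comp_apply]
    rw [← setIntegral_map (hm B hB) hf.aestronglyMeasurable hφ.aemeasurable,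
      ← setIntegral_map (hm B hB) integrable_condExp.aestronglyMeasurable hφ.aemeasurable,
      setIntegral_condExp hm hf hB]
  · exact (stronglyMeasurable_condExp.comp_measurable
      (comap_measurable φ : Measurable[m.comap φ, m] φ)).aestronglyMeasurable

variable [MeasurableSpace Ω] {μ : Measure Ω}

theorem StrictlyStationary.measurePreserving_seqShift (hstat : StrictlyStationary μ X)
    (hX : ∀ i, Measurable (X i)) :
    MeasurePreserving seqShift (μ.map fun ω (i : ℕ) => X i ω) (μ.map fun ω (i : ℕ) => X i ω) := by
  refine ⟨measurable_seqShift, ?_⟩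
  rw [Measure.map_map measurable_seqShift (measurable_pi_lambda _ hX), ← (hstat 1).map_eq]
  congr 1
  funext ω
  exact seqShift_iterate 1 fun j => X j ω

theorem StrictlyStationary.ae_tendsto_average [IsFiniteMeasure μ]
    (hstat : StrictlyStationary μ X) (hX : ∀ i, Measurable (X i)) {f : (ℕ → ℝ) → ℝ}
    (hf : Integrable f (μ.map fun ω i => X i ω)) :
    ∀ᵐ ω ∂μ, Tendsto (fun n : ℕ => (∑ i ∈ Finset.range n, f fun j => X (i + j) ω) / n) atTop
      (𝓝 ((μ[fun ω => f fun j => X j ω | invariantSigma X]) ω)) := by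
  have hφ : Measurable fun ω (i : ℕ) => X i ω := measurable_pi_lambda _ hX
  have hbirkhoff := ae_of_ae_map hφ.aemeasurable
    (ae_tendsto_birkhoffAverage (hstat.measurePreserving_seqShift hX) hf)
  rw [invariantSigma_eq_comap]
  filter_upwards [hbirkhoff, condExp_comp_comap hφ (MeasurableSpace.invariants_le seqShift) hf]
    with ω hω hcondExp
  rw [Function.comp_apply] at hcondExp
  rw [← hcondExp] at hω
  refine hω.congr fun n => ?_
  simp only [birkhoffAverage, birkhoffSum, seqShift_iterate, smul_eq_mul, inv_mul_eq_div]

open scoped Classical in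
/-- The proportion of the numbers `x 0, …, x (n - 1)` that exceed the (extended) level `c`. -/
noncomputable def exceedanceFreq (x : ℕ → ℝ) (c : EReal) (n : ℕ) : ℝ :=
  ((Finset.range n).filter fun i => c < (x i : EReal)).card / n

theorem StrictlyStationary.ae_tendsto_exceedanceFreq [IsFiniteMeasure μ]
    (hstat : StrictlyStationary μ X) (hX : ∀ i, Measurable (X i)) {c : Ω → EReal}
    (hc : Measurable[invariantSigma X] c) :
    ∀ᵐ ω ∂μ, Tendsto (exceedanceFreq (fun i => X i ω) (c ω)) atTop
      (𝓝 ((μ⟦{ω | c ω < (X 0 ω : EReal)} | invariantSigma X⟧) ω)) := by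
  obtain ⟨g, hg, hg_path, hg_shift⟩ := exists_measurable_eq_comp_shift hc
  have hS : MeasurableSet {x : ℕ → ℝ | g x < (x 0 : EReal)} :=
    measurableSet_lt hg (measurable_pi_apply 0).coe_real_ereal
  have := Measure.isFiniteMeasure_map μ fun ω i => X i ω
  filter_upwards [hstat.ae_tendsto_average hX ((integrable_const (1 : ℝ)).indicator hS)] with ω hω
  convert hω using 3 with n
  · simp only [exceedanceFreq, Set.indicator_apply, Set.mem_ofPred_eq, hg_shift, add_zero,
      Finset.sum_boole]
  · ext ω'
    simp only [Set.indicator_apply, Set.mem_ofPred_eq, hg_path]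

theorem StrictlyStationary.ae_forall_le (hstat : StrictlyStationary μ X) {c : Ω → EReal}
    (hc : Measurable[invariantSigma X] c) (hle : ∀ᵐ ω ∂μ, (X 0 ω : EReal) ≤ c ω) :
    ∀ᵐ ω ∂μ, ∀ i, (X i ω : EReal) ≤ c ω := by
  obtain ⟨g, hg, hg_path, hg_shift⟩ := exists_measurable_eq_comp_shift hc
  have hS : MeasurableSet {x : ℕ → ℝ | (x 0 : EReal) ≤ g x} :=
    measurableSet_le (measurable_pi_apply 0).coe_real_ereal hg
  refine ae_all_iff.2 fun i => ?_
  have hi := (hstat i).symm.ae_snd (p := fun x => (x 0 : EReal) ≤ g x) hS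
  simp only [hg_path, hg_shift, add_zero] at hi
  exact hi hle

end Stationary

section Conditional

variable {Ω : Type*} {m m0 : MeasurableSpace Ω} {μ : Measure Ω}

theorem ae_tendsto_condExp_of_antitone (hm : m ≤ m0) [SigmaFinite (μ.trim hm)]
    {f : ℕ → Ω → ℝ} {F : Ω → ℝ} (hf : ∀ n, Integrable (f n) μ) (hF : Integrable F μ)
    (h_anti : ∀ᵐ ω ∂μ, Antitone fun n => f n ω)
    (h_tendsto : ∀ᵐ ω ∂μ, Tendsto (fun n => f n ω) atTop (𝓝 (F ω))) :
    ∀ᵐ ω ∂μ, Tendsto (fun n => (μ[f n | m]) ω) atTop (𝓝 ((μ[F | m]) ω)) := by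
  refine tendsto_of_integral_tendsto_of_antitone (fun _ => integrable_condExp) integrable_condExp
    ?_ ?_ ?_
  · simpa only [integral_condExp hm] using
      integral_tendsto_of_tendsto_of_antitone hf hF h_anti h_tendsto
  · have hsucc := ae_all_iff.2 fun n => condExp_mono (m := m) (hf (n + 1)) (hf n)
      (h_anti.mono fun ω hω => hω n.le_succ)
    exact hsucc.mono fun ω hω => antitone_nat_of_succ_le hω
  · refine ae_all_iff.2 fun n => condExp_mono hF (hf n) ?_
    filter_upwards [h_anti, h_tendsto] with ω h_anti h_tendsto
    exact h_anti.le_of_tendsto h_tendsto n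

theorem ae_tendsto_condProb_lt [IsFiniteMeasure μ] (hm : m ≤ m0) {β : Type*} [LinearOrder β]
    [TopologicalSpace β] [OrderClosedTopology β] [SecondCountableTopology β] [MeasurableSpace β]
    [OpensMeasurableSpace β] {Y d : Ω → β} {c : ℕ → Ω → β} (hY : Measurable Y)
    (hd : Measurable d) (hc : ∀ n, Measurable (c n)) (hc_mono : ∀ ω, Monotone fun n => c n ω)
    (hc_tendsto : ∀ ω, Tendsto (fun n => c n ω) atTop (𝓝 (d ω))) (hYd : μ {ω | Y ω = d ω} = 0) :
    ∀ᵐ ω ∂μ, Tendsto (fun n => (μ⟦{ω | c n ω < Y ω} | m⟧) ω) atTop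
      (𝓝 ((μ⟦{ω | d ω < Y ω} | m⟧) ω)) := by
  refine ae_tendsto_condExp_of_antitone hm
    (fun n => (integrable_const _).indicator (measurableSet_lt (hc n) hY))
    ((integrable_const _).indicator (measurableSet_lt hd hY)) (Eventually.of_forall fun ω => ?_) ?_
  · refine fun i j hij => Set.indicator_le_indicator_of_subset ?_ (fun _ => zero_le_one) ω
    exact fun ω hω => (hc_mono ω hij).trans_lt hω
  · filter_upwards [measure_eq_zero_iff_ae_notMem.1 hYd] with ω hω
    refine tendsto_const_nhds.congr' ?_
    rcases lt_or_gt_of_ne hω with hlt | hgt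
    · filter_upwards [(hc_tendsto ω).eventually_const_lt hlt] with n hn
      simp only [Set.indicator_apply, Set.mem_ofPred_eq, hlt.not_gt, hn.not_gt]
    · filter_upwards [(hc_tendsto ω).eventually_lt_const hgt] with n hn
      simp only [Set.indicator_apply, Set.mem_ofPred_eq, hgt, hn]

theorem condProb_ae_eq_zero {s : Set Ω} (hs : μ s = 0) : μ⟦s | m⟧ =ᵐ[μ] 0 :=
  (condExp_congr_ae (indicator_meas_zero hs)).trans (by rw [condExp_zero])

theorem measure_inter_condProb_nonpos [IsFiniteMeasure μ] (hm : m ≤ m0) {s : Set Ω}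
    (hs : MeasurableSet s) : μ (s ∩ {ω | (μ⟦s | m⟧) ω ≤ 0}) = 0 := by
  have hA : MeasurableSet[m] {ω | (μ⟦s | m⟧) ω ≤ 0} :=
    measurableSet_le stronglyMeasurable_condExp.measurable measurable_const
  have hle := setIntegral_nonpos (μ := μ) (hm _ hA) fun ω hω => hω
  rw [setIntegral_condExp hm ((integrable_const _).indicator hs) hA, integral_indicator_const _ hs,
    smul_eq_mul, mul_one, measureReal_restrict_apply hs] at hle
  exact (measureReal_eq_zero_iff).1 (hle.antisymm measureReal_nonneg)

theorem IsCondRightEndpoint.ae_le [IsProbabilityMeasure μ] {Y : Ω → ℝ} {γ : Ω → EReal}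
    (hγ : IsCondRightEndpoint μ Y m γ) (hm : m ≤ m0) (hY : Measurable Y) :
    ∀ᵐ ω ∂μ, (Y ω : EReal) ≤ γ ω :=
  (condProb_eq_one_iff μ m hm _
    (measurableSet_le hY.coe_real_ereal (hγ.measurable.mono hm le_rfl))).1 hγ.le_endpoint

theorem IsCondRightEndpoint.ae_condProb_pos [IsProbabilityMeasure μ] {Y : Ω → ℝ} {γ : Ω → EReal}
    (hγ : IsCondRightEndpoint μ Y m γ) (hm : m ≤ m0) (hY : Measurable Y) {Q : Ω → EReal}
    (hQ : Measurable[m] Q) :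
    ∀ᵐ ω ∂μ, Q ω < γ ω → 0 < (μ⟦{ω | Q ω < (Y ω : EReal)} | m⟧) ω := by
  classical
  set V := μ⟦{ω | Q ω < (Y ω : EReal)} | m⟧
  -- Were `V` zero with positive probability, lowering `γ` to `Q` there would contradict minimality.
  set Q' : Ω → EReal := fun ω => if V ω ≤ 0 then Q ω else ⊤
  have hV : MeasurableSet[m] {ω | V ω ≤ 0} :=
    measurableSet_le stronglyMeasurable_condExp.measurable measurable_const
  have hQ' : Measurable[m] Q' := Measurable.ite hV hQ measurable_const
  have hnull : μ ({ω | Q ω < (Y ω : EReal)} ∩ {ω | V ω ≤ 0}) = 0 :=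
    measure_inter_condProb_nonpos hm (measurableSet_lt (hQ.mono hm le_rfl) hY.coe_real_ereal)
  have hYQ' : ∀ᵐ ω ∂μ, (Y ω : EReal) ≤ Q' ω := by
    filter_upwards [measure_eq_zero_iff_ae_notMem.1 hnull] with ω hω
    simp only [Q']
    split_ifs with hVω
    · exact not_lt.1 fun hlt => hω ⟨hlt, hVω⟩
    · exact le_top
  have hγQ' := hγ.minimal Q' hQ' ((condProb_eq_one_iff μ m hm _
    (measurableSet_le hY.coe_real_ereal (hQ'.mono hm le_rfl))).2 hYQ')
  filter_upwards [hγQ'] with ω hω hlt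
  by_contra! hVω
  simp only [Q', if_pos hVω] at hω
  exact hlt.not_ge hω

end Conditional

section ApproxBelow

/-- The `m`-th term of a canonical increasing sequence of levels that converges to `c`, all strictly
below `c` unless `c = ⊥`. Truncating at `m` before subtracting keeps this true at `c = ⊤`. -/
noncomputable def approxBelow (c : EReal) (m : ℕ) : EReal :=
  min c (m : ℝ) - ((1 / (m + 1) : ℝ) : EReal)

theorem measurable_approxBelow (m : ℕ) : Measurable fun c => approxBelow c m :=
  Monotone.measurable fun _ _ hcd => EReal.sub_le_sub (min_le_min_right _ hcd) le_rfl

theorem monotone_approxBelow (c : EReal) : Monotone (approxBelow c) := by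
  intro i j hij
  exact EReal.sub_le_sub (min_le_min_left _ (EReal.coe_le_coe (Nat.mono_cast hij)))
    (EReal.coe_le_coe (Nat.one_div_le_one_div hij))

theorem approxBelow_lt {c : EReal} (hc : c ≠ ⊥) (m : ℕ) : approxBelow c m < c := by
  have hmin_ne_bot : min c (m : ℝ) ≠ ⊥ :=
    (lt_min (bot_lt_iff_ne_bot.2 hc) (EReal.bot_lt_coe _)).ne'
  have hmin_ne_top : min c (m : ℝ) ≠ ⊤ := ((min_le_right _ _).trans_lt (EReal.coe_lt_top _)).ne
  have hpos : (0 : EReal) < ((1 / (m + 1) : ℝ) : EReal) :=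
    EReal.coe_pos.2 Nat.one_div_pos_of_nat
  calc approxBelow c m < min c (m : ℝ) - 0 :=
        EReal.sub_lt_sub_of_le_of_gt le_rfl hpos hmin_ne_top hmin_ne_bot
    _ ≤ c := by rw [sub_zero]; exact min_le_left _ _

theorem tendsto_sub_coe {ι : Type*} {l : Filter ι} {f : ι → EReal} {g : ι → ℝ} {c : EReal} {r : ℝ}
    (hf : Tendsto f l (𝓝 c)) (hg : Tendsto g l (𝓝 r)) :
    Tendsto (fun i => f i - (g i : EReal)) l (𝓝 (c - r)) := by
  simp only [sub_eq_add_neg, ← EReal.coe_neg]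
  have hadd : ContinuousAt (fun p : EReal × EReal => p.1 + p.2) (c, ((-r : ℝ) : EReal)) :=
    EReal.continuousAt_add (.inr (EReal.coe_ne_bot _)) (.inr (EReal.coe_ne_top _))
  exact hadd.tendsto.comp (hf.prodMk_nhds (EReal.tendsto_coe.2 hg.neg))

theorem tendsto_approxBelow (c : EReal) : Tendsto (approxBelow c) atTop (𝓝 c) := by
  have hmin : Tendsto (fun m : ℕ => min c (m : ℝ)) atTop (𝓝 c) := by
    simpa only [min_top_right] using
      tendsto_const_nhds.min (EReal.tendsto_coe_nhds_top_iff.2 tendsto_natCast_atTop_atTop)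
  have hsub := tendsto_sub_coe hmin (tendsto_one_div_add_atTop_nhds_zero_nat (𝕜 := ℝ))
  rwa [EReal.coe_zero, sub_zero] at hsub

theorem monotone_sub_coe (r : ℝ) : Monotone fun c : EReal => c - r :=
  fun _ _ h => EReal.sub_le_sub h le_rfl

theorem measurable_sub_coe (r : ℝ) : Measurable fun c : EReal => c - r :=
  (monotone_sub_coe r).measurable

variable {Ω : Type*} {m m0 : MeasurableSpace Ω} {μ : Measure Ω} {Y : Ω → ℝ}

theorem ae_tendsto_condProb_approxBelow_sub_lt [IsFiniteMeasure μ] (hm : m ≤ m0)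
    (hY : Measurable Y) {c : Ω → EReal} (hc : Measurable c) {a : ℝ}
    (hYc : μ {ω | (Y ω : EReal) = c ω - a} = 0) :
    ∀ᵐ ω ∂μ, Tendsto (fun n => (μ⟦{ω | approxBelow (c ω) n - a < (Y ω : EReal)} | m⟧) ω) atTop
      (𝓝 ((μ⟦{ω | c ω - a < (Y ω : EReal)} | m⟧) ω)) :=
  ae_tendsto_condProb_lt hm hY.coe_real_ereal ((measurable_sub_coe a).comp hc)
    (fun n => (measurable_sub_coe a).comp ((measurable_approxBelow n).comp hc))
    (fun ω => (monotone_sub_coe a).comp (monotone_approxBelow (c ω)))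
    (fun ω => tendsto_sub_coe (tendsto_approxBelow (c ω)) tendsto_const_nhds) hYc

theorem IsCondRightEndpoint.ae_tendsto_condProb_approxBelow_lt [IsProbabilityMeasure μ]
    {γ : Ω → EReal} (hγ : IsCondRightEndpoint μ Y m γ) (hm : m ≤ m0) (hY : Measurable Y)
    (h_end : μ {ω | (Y ω : EReal) = γ ω} = 0) :
    ∀ᵐ ω ∂μ, Tendsto (fun n => (μ⟦{ω | approxBelow (γ ω) n < (Y ω : EReal)} | m⟧) ω) atTop
      (𝓝 0) := by
  have hγ_meas : Measurable γ := hγ.measurable.mono hm le_rfl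
  have hzero : μ⟦{ω | γ ω < (Y ω : EReal)} | m⟧ =ᵐ[μ] 0 := condProb_ae_eq_zero <| by
    simpa only [ae_iff, not_le] using hγ.ae_le hm hY
  filter_upwards [hzero, ae_tendsto_condProb_lt hm hY.coe_real_ereal hγ_meas
    (fun n => (measurable_approxBelow n).comp hγ_meas) (fun ω => monotone_approxBelow (γ ω))
    (fun ω => tendsto_approxBelow (γ ω)) h_end] with ω hω hlim
  rwa [hω] at hlim

theorem IsCondRightEndpoint.ae_condProb_approxBelow_lt_pos [IsProbabilityMeasure μ]
    {γ : Ω → EReal} (hγ : IsCondRightEndpoint μ Y m γ) (hm : m ≤ m0) (hY : Measurable Y) (n : ℕ) :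
    ∀ᵐ ω ∂μ, 0 < (μ⟦{ω | approxBelow (γ ω) n < (Y ω : EReal)} | m⟧) ω := by
  filter_upwards [hγ.ae_le hm hY,
    hγ.ae_condProb_pos hm hY ((measurable_approxBelow n).comp hγ.measurable)] with ω hYγ hpos
  exact hpos (approxBelow_lt ((EReal.bot_lt_coe _).trans_le hYγ).ne' n)

end ApproxBelow

section OrderStatistics

theorem exists_monotone_perm_orderStat_eq (x : ℕ → ℝ) {k n : ℕ} (hk : 1 ≤ k) (hkn : k ≤ n) :
    ∃ σ : Equiv.Perm (Fin n), Monotone (fun i => x (σ i)) ∧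
      orderStat x k n = x (σ ⟨k - 1, by omega⟩) := by
  refine ⟨Tuple.sort fun i : Fin n => x i, Tuple.monotone_sort fun i : Fin n => x i, ?_⟩
  rw [orderStat, dif_pos ⟨hk, hkn⟩]

theorem le_card_le_orderStat (x : ℕ → ℝ) {k n : ℕ} (hk : 1 ≤ k) (hkn : k ≤ n) :
    k ≤ ((Finset.range n).filter fun i => x i ≤ orderStat x k n).card := by
  obtain ⟨σ, hmono, hσ⟩ := exists_monotone_perm_orderStat_eq x hk hkn
  have hcard := (Tuple.lt_card_le_iff_apply_le_of_monotone hmono).2 hσ.ge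
  rw [Finset.card_filter, Equiv.sum_comp σ fun i => if x i ≤ orderStat x k n then 1 else 0,
    Fin.sum_univ_eq_sum_range fun i => if x i ≤ orderStat x k n then 1 else 0,
    ← Finset.card_filter] at hcard
  exact Nat.le_of_pred_lt hcard

theorem eventually_lt_orderStat {x : ℕ → ℝ} {k : ℕ → ℕ} (hk : ∀ n, 1 ≤ n → 1 ≤ k n ∧ k n ≤ n)
    (hk_lim : Tendsto (fun n : ℕ => (k n : ℝ) / (n : ℝ)) atTop (𝓝 1)) {c : EReal} {v : ℝ}
    (hv : 0 < v) (hc : Tendsto (exceedanceFreq x c) atTop (𝓝 v)) :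
    ∀ᶠ n in atTop, c < (orderStat x (k n) n : EReal) := by
  have hsum := (hk_lim.add hc).eventually_const_lt (lt_add_of_pos_right 1 hv)
  filter_upwards [hsum, eventually_ge_atTop 1] with n hn hn_pos
  by_contra! hle
  have hcard : k n + ((Finset.range n).filter fun i => c < (x i : EReal)).card ≤ n := by
    calc k n + ((Finset.range n).filter fun i => c < (x i : EReal)).card
      _ ≤ ((Finset.range n).filter fun i => (x i : EReal) ≤ c).card +
          ((Finset.range n).filter fun i => c < (x i : EReal)).card := by
        refine Nat.add_le_add_right ((le_card_le_orderStat x (hk n hn_pos).1 (hk n hn_pos).2).trans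
          (Finset.card_le_card (Finset.monotone_filter_right _ fun i _ hi => ?_))) _
        exact (EReal.coe_le_coe hi).trans hle
      _ = n := by
        simpa only [not_le, Finset.card_range] using Finset.card_filter_add_card_filter_not
          (s := Finset.range n) fun i => (x i : EReal) ≤ c
  rw [exceedanceFreq, ← add_div, one_lt_div (by exact_mod_cast hn_pos)] at hn
  exact hn.not_ge (by exact_mod_cast hcard)

theorem nearCount_div_le_exceedanceFreq {x : ℕ → ℝ} {k n : ℕ} {a : ℝ} {u : EReal}
    (hu : u < (orderStat x k n : EReal)) :
    (nearCount x k n a : ℝ) / n ≤ exceedanceFreq x (u - a) n := by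
  rw [nearCount, exceedanceFreq]
  gcongr with i
  intro hi
  exact (monotone_sub_coe a hu.le).trans_lt (EReal.coe_lt_coe hi.1)

theorem exceedanceFreq_sub_le_nearCount_div {x : ℕ → ℝ} {k n : ℕ} {a : ℝ} {u γ : EReal}
    (hu : u < (orderStat x k n : EReal)) (hγ : (orderStat x k n : EReal) ≤ γ) :
    exceedanceFreq x (γ - a) n - exceedanceFreq x u n ≤ (nearCount x k n a : ℝ) / n := by
  classical
  rw [nearCount, exceedanceFreq, exceedanceFreq, ← sub_div]
  gcongr
  rw [sub_le_iff_le_add]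
  norm_cast
  refine (Finset.card_le_card fun i hi => ?_).trans (Finset.card_union_le _ _)
  simp only [Finset.mem_union, Finset.mem_filter] at hi ⊢
  rcases lt_or_ge u (x i : EReal) with hui | hiu
  · exact .inr ⟨hi.1, hui⟩
  · refine .inl ⟨hi.1, EReal.coe_lt_coe_iff.1 ?_, EReal.coe_lt_coe_iff.1 (hiu.trans_lt hu)⟩
    exact (monotone_sub_coe a hγ).trans_lt hi.2

theorem tendsto_nearCount_div {x : ℕ → ℝ} {k : ℕ → ℕ} (hk : ∀ n, 1 ≤ n → 1 ≤ k n ∧ k n ≤ n)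
    (hk_lim : Tendsto (fun n : ℕ => (k n : ℝ) / (n : ℝ)) atTop (𝓝 1)) {a : ℝ} {γ : EReal}
    (hx : ∀ i, (x i : EReal) ≤ γ) {u : ℕ → EReal} {v w : ℕ → ℝ} {p : ℝ}
    (hu : ∀ m, Tendsto (exceedanceFreq x (u m)) atTop (𝓝 (v m))) (hv_pos : ∀ m, 0 < v m)
    (hv : Tendsto v atTop (𝓝 0))
    (hua : ∀ m, Tendsto (exceedanceFreq x (u m - a)) atTop (𝓝 (w m)))
    (hw : Tendsto w atTop (𝓝 p)) (hγ : Tendsto (exceedanceFreq x (γ - a)) atTop (𝓝 p)) :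
    Tendsto (fun n : ℕ => (nearCount x (k n) n a : ℝ) / (n : ℝ)) atTop (𝓝 p) := by
  have hlt (m : ℕ) : ∀ᶠ n in atTop, u m < (orderStat x (k n) n : EReal) :=
    eventually_lt_orderStat hk hk_lim (hv_pos m) (hu m)
  refine tendsto_order.2 ⟨fun b hb => ?_, fun b hb => ?_⟩
  · obtain ⟨m, hm⟩ := (hv.eventually_lt_const (sub_pos.2 hb)).exists
    filter_upwards [hlt m, (hγ.sub (hu m)).eventually_const_lt (lt_sub_comm.1 hm),
      eventually_ge_atTop 1] with n hn hb_lt hn_pos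
    obtain ⟨σ, -, hσ⟩ := exists_monotone_perm_orderStat_eq x (hk n hn_pos).1 (hk n hn_pos).2
    exact hb_lt.trans_le (exceedanceFreq_sub_le_nearCount_div hn (hσ ▸ hx _))
  · obtain ⟨m, hm⟩ := (hw.eventually_lt_const hb).exists
    filter_upwards [hlt m, (hua m).eventually_lt_const hm] with n hn hlt_b
    exact (nearCount_div_le_exceedanceFreq hn).trans_lt hlt_b

end OrderStatistics

theorem theorem3p3 {Ω : Type*} [MeasurableSpace Ω] (μ : Measure Ω) [IsProbabilityMeasure μ]
    (X : ℕ → Ω → ℝ) (hX : ∀ i, Measurable (X i)) (hstat : StrictlyStationary μ X)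
    (k : ℕ → ℕ) (hk : ∀ n, 1 ≤ n → 1 ≤ k n ∧ k n ≤ n)
    (hk_lim : Tendsto (fun n : ℕ => (k n : ℝ) / (n : ℝ)) atTop (𝓝 1))
    (a : ℝ) (ha : 0 < a)
    (γ : Ω → EReal) (hγ : IsCondRightEndpoint μ (X 0) (invariantSigma X) γ)
    (h_end : μ {ω | (X 0 ω : EReal) = γ ω} = 0)
    (h_shift : μ {ω | (X 0 ω : EReal) = γ ω - (a : EReal)} = 0) :
    ∀ᵐ ω ∂μ, Tendsto (fun n : ℕ => (nearCount (fun i => X i ω) (k n) n a : ℝ) / (n : ℝ)) atTop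
      (𝓝 ((μ⟦{ω' | γ ω' - (a : EReal) < (X 0 ω' : EReal)} | invariantSigma X⟧) ω)) := by
  have hle := invariantSigma_le X hX
  have hu (m : ℕ) : Measurable[invariantSigma X] fun ω => approxBelow (γ ω) m :=
    (measurable_approxBelow m).comp hγ.measurable
  filter_upwards [hstat.ae_forall_le hγ.measurable (hγ.ae_le hle (hX 0)),
    ae_all_iff.2 fun m => hstat.ae_tendsto_exceedanceFreq hX (hu m),
    ae_all_iff.2 fun m => hγ.ae_condProb_approxBelow_lt_pos hle (hX 0) m,
    hγ.ae_tendsto_condProb_approxBelow_lt hle (hX 0) h_end,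
    ae_all_iff.2 fun m => hstat.ae_tendsto_exceedanceFreq hX ((measurable_sub_coe a).comp (hu m)),
    ae_tendsto_condProb_approxBelow_sub_lt hle (hX 0) (hγ.measurable.mono hle le_rfl) h_shift,
    hstat.ae_tendsto_exceedanceFreq hX ((measurable_sub_coe a).comp hγ.measurable)]
    with ω hXγ hfreq hpos hlim hfreq_sub hlim_sub hfreq_end
  exact tendsto_nearCount_div hk hk_lim hXγ hfreq hpos hlim hfreq_sub hlim_sub hfreq_end
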